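/- Let $\mathcal X=(\mathcal X,\otimes,I)$ and $\mathcal W$ be symmetric monoidal closed categories, with internal homs $\underline{\mathcal X}(-,-)$, $\underline{\mathcal W}(-,-)$ and evaluations $\mathrm{Ev}: A\otimes \underline{\mathcal X}(A,B)\to B$, and write $\underline{\mathcal X}$, $\underline{\mathcal W}$ also for the categories regarded as enriched in themselves. Let $F\dashv G:\mathcal W\to\mathcal X$ be a symmetric monoidal adjunction, i.e. $F$ and $G$ are symmetric (lax) monoidal functors and the unit $\eta$ and counit $\epsilon$ are monoidal transformations. Let $\mathbb T=(T,\eta,\mu)$, $T=GF$, $\mu=G\epsilon F$, be the induced symmetric monoidal monad on $\mathcal X$. *The commutative $\mathcal X$-monad $\mathbb T^c$.* Let $(\mathbf T,\eta,\mu)$ be an $\mathcal X$-monad on $\underline{\mathcal X}$. Let $t'_{XY}:TX\otimes Y\to T(X\otimes Y)$ and $t''_{XY}:X\otimes TY\to T(X\otimes Y)$ be the transposes of $Y\to\underline{\mathcal X}(X,X\otimes Y)\xrightarrow{\mathbf T}\underline{\mathcal X}(TX,T(X\otimes Y))$ and $X\to\underline{\mathcal X}(Y,X\otimes Y)\xrightarrow{\mathbf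 T}\underline{\mathcal X}(TY,T(X\otimes Y))$, and put $\otimes_{XY}=\mu\cdot Tt'_{XY}\cdot t''_{TX,Y}$ and $\widetilde\otimes_{XY}=\mu\cdot Tt''_{XY}\cdot t'_{X,TY}: TX\otimes TY\to T(X\otimes Y)$. The $\mathcal X$-monad is commutative if $\otimes_{XY}=\widetilde\otimes_{XY}$ for all $X,Y$. Kock's correspondence assigns to an $\mathcal X$-enrichment of $T$ making $\mathbb T$ a commutative $\mathcal X$-monad the monoidal structure on $T$ consisting of the morphisms $\otimes_{XY}$ and $\eta_I$. Let $\mathbb T^c=(\mathbf T^c,\eta,\mu)$ be the $\mathcal X$-monad for which $\mathbf T^c_{XY}:\underline{\mathcal X}(X,Y)\to\underline{\mathcal X}(TX,TY)$ is the transpose of $$TX\otimes\underline{\mathcal X}(X,Y)\xrightarrow{1\otimes\eta}TX\otimes T\underline{\mathcal X}(X,Y)\to T(X\otimes\underline{\mathcal X}(X,Y))\xrightarrow{T(\mathrm{Ev})}TY.$$ *The $\mathcal X$-monad $\mathbb T'$.* For a symmetric monoidal functor $M:\mathcal U\to\mathcal V$ between symmetric monoidal closed categories, let $\grave M:M_*\underline{\mathcal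 U}\to\underline{\mathcal V}$ be the $\mathcal V$-functor given on objects by $M$ and on homs by the transposes of $MA\otimes M\underline{\mathcal U}(A,B)\to M(A\otimes\underline{\mathcal U}(A,B))\xrightarrow{M(\mathrm{Ev})}MB$, where $M_*$ is change of base. Let $\acute F:\underline{\mathcal X}\to G_*\underline{\mathcal W}$ be the transpose of $\grave F:F_*\underline{\mathcal X}\to\underline{\mathcal W}$ under $F_*\dashv G_*$. Then $\acute F\dashv\grave G$ is an $\mathcal X$-adjunction with unit and counit given by $\eta$ and $\epsilon$; let $\mathbb T'$ be the $\mathcal X$-monad on $\underline{\mathcal X}$ that it induces. Then: 1. $\mathbb T^c$ is the commutative $\mathcal X$-monad associated to the symmetric monoidal monad $\mathbb T$ by Kock's correspondence: an $\mathcal X$-enrichment of $T$ making $\mathbb T$ an $\mathcal X$-monad is commutative with associated monoidal structure that of $\mathbb T$ if and only if it is the enrichment $\mathbf T^c$. 2. $\mathbb T^c=\mathbb T'$ as $\mathcal X$-monads on $\underline{\mathcal X}$. 3. In particular, $\mathbb T'$ is commutative. -/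

import Mathlib

open CategoryTheory MonoidalCategory Functor.LaxMonoidal
open scoped MonoidalClosed

namespace EnrichedMonadTheory

universe w w' v v' v'' u u' u''

section Grave

variable {V : Type u} [Category.{v} V] [MonoidalCategory V] [MonoidalClosed V]
  {W : Type u'} [Category.{v'} W] [MonoidalCategory W] [MonoidalClosed W]

lemma whiskerLeft_comp_ev (X Y Z : V) :
    X ◁ MonoidalClosed.comp X Y Z ≫ (ihom.ev X).app Z =
      (α_ _ _ _).inv ≫ (ihom.ev X).app Y ▷ _ ≫ (ihom.ev Y).app Z := by
  rw [MonoidalClosed.comp_eq, MonoidalClosed.whiskerLeft_curry_ihom_ev_app,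
    MonoidalClosed.compTranspose_eq]

lemma whiskerLeft_id_ev (X : V) :
    X ◁ MonoidalClosed.id X ≫ (ihom.ev X).app X = (ρ_ X).hom := by
  rw [MonoidalClosed.id_eq, MonoidalClosed.whiskerLeft_curry_ihom_ev_app]

/-- The canonical comparison `M V(X, Y) ⟶ W(M X, M Y)`, the transpose of
`M X ⊗ M V(X, Y) ⟶ M (X ⊗ V(X, Y)) ⟶ M Y`. -/
def graveMap (M : V ⥤ W) [M.LaxMonoidal] (X Y : V) :
    M.obj ((ihom X).obj Y) ⟶ (ihom (M.obj X)).obj (M.obj Y) :=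
  MonoidalClosed.curry (μ M X ((ihom X).obj Y) ≫ M.map ((ihom.ev X).app Y))

lemma whiskerLeft_graveMap_ev (M : V ⥤ W) [M.LaxMonoidal] (X Y : V) :
    M.obj X ◁ graveMap M X Y ≫ (ihom.ev (M.obj X)).app (M.obj Y) =
      μ M X ((ihom X).obj Y) ≫ M.map ((ihom.ev X).app Y) := by
  rw [graveMap, MonoidalClosed.whiskerLeft_curry_ihom_ev_app]

lemma hom_ext_ev {X Y A : V} {f g : A ⟶ (ihom X).obj Y}
    (h : X ◁ f ≫ (ihom.ev X).app Y = X ◁ g ≫ (ihom.ev X).app Y) : f = g :=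
  MonoidalClosed.uncurry_injective (by rwa [MonoidalClosed.uncurry_eq, MonoidalClosed.uncurry_eq])

lemma graveMap_id (M : V ⥤ W) [M.LaxMonoidal] (X : V) :
    (ε M ≫ M.map (MonoidalClosed.id X)) ≫ graveMap M X X = MonoidalClosed.id (M.obj X) := by
  apply hom_ext_ev
  rw [whiskerLeft_id_ev, MonoidalCategory.whiskerLeft_comp, Category.assoc,
    whiskerLeft_graveMap_ev, MonoidalCategory.whiskerLeft_comp, Category.assoc,
    μ_natural_right_assoc, ← M.map_comp, whiskerLeft_id_ev, ← right_unitality]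

lemma graveMap_comp (M : V ⥤ W) [M.LaxMonoidal] (X Y Z : V) :
    (μ M _ _ ≫ M.map (MonoidalClosed.comp X Y Z)) ≫ graveMap M X Z =
      (graveMap M X Y ⊗ₘ graveMap M Y Z) ≫
        MonoidalClosed.comp (M.obj X) (M.obj Y) (M.obj Z) := by
  apply hom_ext_ev
  rw [MonoidalCategory.whiskerLeft_comp, Category.assoc, whiskerLeft_graveMap_ev,
    MonoidalCategory.whiskerLeft_comp, Category.assoc, μ_natural_right_assoc, ← M.map_comp,
    whiskerLeft_comp_ev, MonoidalCategory.whiskerLeft_comp, Category.assoc, whiskerLeft_comp_ev,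
    MonoidalCategory.tensorHom_def, MonoidalCategory.whiskerLeft_comp, Category.assoc,
    associator_inv_naturality_right_assoc, whisker_exchange_assoc]
  dsimp only [Functor.id_obj]
  rw [whiskerLeft_graveMap_ev,
    associator_inv_naturality_middle_assoc, ← comp_whiskerRight_assoc, whiskerLeft_graveMap_ev,
    M.map_comp, M.map_comp, comp_whiskerRight, Category.assoc]
  dsimp only [Functor.id_obj]
  rw [μ_natural_left_assoc, associativity_inv_assoc]

/-- The `W`-functor `M_* V ⟶ W` associated with a lax monoidal functor `M : V ⥤ W`. -/
def grave (M : V ⥤ W) [M.LaxMonoidal] : EnrichedFunctor W (TransportEnrichment M V) W where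
  obj X := M.obj X
  map X Y := graveMap M X Y
  map_id X := graveMap_id M X
  map_comp X Y Z := graveMap_comp M X Y Z

end Grave

section ChangeOfBase

variable {V : Type u} [Category.{v} V] [MonoidalCategory V]
  {W : Type u'} [Category.{v'} W] [MonoidalCategory W]
  {C : Type w} [EnrichedCategory V C] {D : Type w'} [EnrichedCategory V D]

/-- The action of change of base along `M` on enriched functors. -/
def changeBase (M : V ⥤ W) [M.LaxMonoidal] (H : EnrichedFunctor V C D) :
    EnrichedFunctor W (TransportEnrichment M C) (TransportEnrichment M D) where
  obj X := H.obj X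
  map X Y := M.map (H.map X Y)
  map_id := by
    have h (X : C) : (ε M ≫ M.map (eId V X)) ≫ M.map (H.map X X) =
        ε M ≫ M.map (eId V (H.obj X)) := by
      rw [Category.assoc, ← M.map_comp, H.map_id]
    exact h
  map_comp := by
    have h (X Y Z : C) : (μ M _ _ ≫ M.map (eComp V X Y Z)) ≫ M.map (H.map X Z) =
        (M.map (H.map X Y) ⊗ₘ M.map (H.map Y Z)) ≫
          μ M _ _ ≫ M.map (eComp V (H.obj X) (H.obj Y) (H.obj Z)) := by
      rw [Category.assoc, ← M.map_comp, H.map_comp, M.map_comp, μ_natural_assoc]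
    exact h

variable {F : V ⥤ W} {G : W ⥤ V} [F.LaxMonoidal] [G.LaxMonoidal]

lemma unit_tensorUnit_naturality (adj : F ⊣ G) [NatTrans.IsMonoidal adj.unit] {A : V}
    (a : 𝟙_ V ⟶ A) : a ≫ adj.unit.app A = (ε G ≫ G.map (ε F)) ≫ G.map (F.map a) := by
  have h := NatTrans.IsMonoidal.unit (τ := adj.unit)
  rw [id_ε, comp_ε, Category.id_comp] at h
  rw [← h]
  exact adj.unit.naturality a

lemma unit_tensor_naturality (adj : F ⊣ G) [NatTrans.IsMonoidal adj.unit] {A B E : V}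
    (a : A ⊗ B ⟶ E) :
    a ≫ adj.unit.app E = (adj.unit.app A ⊗ₘ adj.unit.app B) ≫
      μ G (F.obj A) (F.obj B) ≫ G.map (μ F A B) ≫ G.map (F.map a) := by
  have h := NatTrans.IsMonoidal.tensor (τ := adj.unit) A B
  rw [id_μ, comp_μ, Category.id_comp] at h
  have h2 := adj.unit.naturality a
  dsimp only [Functor.id_obj, Functor.id_map, Functor.comp_obj, Functor.comp_map] at h h2
  rw [h2, h, Category.assoc, Category.assoc]

/-- The component at `C` of the unit of the adjunction `F_* ⊣ G_*`. -/
def changeBaseUnit (adj : F ⊣ G) [NatTrans.IsMonoidal adj.unit] (C : Type w)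
    [EnrichedCategory V C] :
    EnrichedFunctor V C (TransportEnrichment G (TransportEnrichment F C)) where
  obj X := X
  map X Y := adj.unit.app (X ⟶[V] Y)
  map_id := by
    have h (X : C) : eId V X ≫ adj.unit.app (X ⟶[V] X) =
        ε G ≫ G.map (ε F ≫ F.map (eId V X)) := by
      rw [unit_tensorUnit_naturality adj, Category.assoc, G.map_comp]
    exact h
  map_comp := by
    have h (X Y Z : C) : eComp V X Y Z ≫ adj.unit.app (X ⟶[V] Z) =
        (adj.unit.app (X ⟶[V] Y) ⊗ₘ adj.unit.app (Y ⟶[V] Z)) ≫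
          μ G _ _ ≫ G.map (μ F _ _ ≫ F.map (eComp V X Y Z)) := by
      rw [unit_tensor_naturality adj, G.map_comp]
    exact h

end ChangeOfBase

section VNat

variable {V : Type u} [Category.{v} V] [MonoidalCategory V]

section

variable {C : Type w} [EnrichedCategory V C]

/-- Precomposition with an element `a : 𝟙_ V ⟶ C(X, Y)`. -/
def ePre {X Y : C} (a : 𝟙_ V ⟶ (X ⟶[V] Y)) (Z : C) : (Y ⟶[V] Z) ⟶ (X ⟶[V] Z) :=
  (λ_ _).inv ≫ a ▷ _ ≫ eComp V X Y Z

/-- Postcomposition with an element `b : 𝟙_ V ⟶ C(Y, Z)`. -/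
def ePost (X : C) {Y Z : C} (b : 𝟙_ V ⟶ (Y ⟶[V] Z)) : (X ⟶[V] Y) ⟶ (X ⟶[V] Z) :=
  (ρ_ _).inv ≫ _ ◁ b ≫ eComp V X Y Z

/-- Composition of elements `𝟙_ V ⟶ C(X, Y)` and `𝟙_ V ⟶ C(Y, Z)`, that is, composition in the
underlying ordinary category of `C`. -/
def uComp {X Y Z : C} (a : 𝟙_ V ⟶ (X ⟶[V] Y)) (b : 𝟙_ V ⟶ (Y ⟶[V] Z)) :
    𝟙_ V ⟶ (X ⟶[V] Z) :=
  (λ_ (𝟙_ V)).inv ≫ (a ⊗ₘ b) ≫ eComp V X Y Z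

lemma comp_ePost {X Y Z : C} (a : 𝟙_ V ⟶ (X ⟶[V] Y)) (b : 𝟙_ V ⟶ (Y ⟶[V] Z)) :
    a ≫ ePost X b = uComp a b := by
  rw [ePost, uComp, rightUnitor_inv_naturality_assoc, MonoidalCategory.tensorHom_def,
    Category.assoc, unitors_inv_equal]

lemma comp_ePre {X Y Z : C} (a : 𝟙_ V ⟶ (X ⟶[V] Y)) (b : 𝟙_ V ⟶ (Y ⟶[V] Z)) :
    b ≫ ePre a Z = uComp a b := by
  rw [ePre, uComp, leftUnitor_inv_naturality_assoc, MonoidalCategory.tensorHom_def',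
    Category.assoc]

variable {D : Type w'} [EnrichedCategory V D]

lemma ePre_map (H : EnrichedFunctor V C D) {X Y : C} (a : 𝟙_ V ⟶ (X ⟶[V] Y)) (Z : C) :
    ePre a Z ≫ H.map X Z = H.map Y Z ≫ ePre (a ≫ H.map X Y) (H.obj Z) := by
  rw [ePre, ePre, Category.assoc, Category.assoc, H.map_comp, leftUnitor_inv_naturality_assoc,
    comp_whiskerRight, Category.assoc, MonoidalCategory.tensorHom_def, Category.assoc,
    whisker_exchange_assoc, whisker_exchange_assoc]

lemma ePost_map (H : EnrichedFunctor V C D) (X : C) {Y Z : C} (b : 𝟙_ V ⟶ (Y ⟶[V] Z)) :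
    ePost X b ≫ H.map X Z = H.map X Y ≫ ePost (H.obj X) (b ≫ H.map Y Z) := by
  rw [ePost, ePost, Category.assoc, Category.assoc, H.map_comp, rightUnitor_inv_naturality_assoc,
    MonoidalCategory.whiskerLeft_comp, Category.assoc, MonoidalCategory.tensorHom_def,
    Category.assoc, whisker_exchange_assoc]

lemma uComp_map (H : EnrichedFunctor V C D) {X Y Z : C} (a : 𝟙_ V ⟶ (X ⟶[V] Y))
    (b : 𝟙_ V ⟶ (Y ⟶[V] Z)) :
    uComp a b ≫ H.map X Z = uComp (a ≫ H.map X Y) (b ≫ H.map Y Z) := by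
  rw [← comp_ePost, Category.assoc, ePost_map, ← comp_ePost, Category.assoc]

/-- A `V`-natural transformation between `V`-functors: components `𝟙_ V ⟶ D(F X, G X)` such that
the two induced morphisms `C(X, Y) ⟶ D(F X, G Y)` in `V` agree. (This is stronger than naturality
of the underlying ordinary transformation.) -/
structure VNatTrans (F G : EnrichedFunctor V C D) where
  app (X : C) : 𝟙_ V ⟶ (F.obj X ⟶[V] G.obj X)
  naturality (X Y : C) :
    G.map X Y ≫ ePre (app X) (G.obj Y) = F.map X Y ≫ ePost (F.obj X) (app Y)

end

/-- A `V`-monad on a `V`-category `C`. -/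
structure VMonad (C : Type w) [EnrichedCategory V C] where
  functor : EnrichedFunctor V C C
  unit : VNatTrans (EnrichedFunctor.id V C) functor
  mul : VNatTrans (functor.comp V functor) functor
  left_unit (X : C) : uComp (unit.app (functor.obj X)) (mul.app X) = eId V (functor.obj X)
  right_unit (X : C) :
    uComp (unit.app X ≫ functor.map X (functor.obj X)) (mul.app X) = eId V (functor.obj X)
  assoc (X : C) :
    uComp (mul.app X ≫ functor.map (functor.obj (functor.obj X)) (functor.obj X)) (mul.app X) =
      uComp (mul.app (functor.obj X)) (mul.app X)

/-- A `V`-adjunction between `V`-categories, given by unit and counit. -/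
structure VAdjunction {C : Type w} [EnrichedCategory V C] {D : Type w'} [EnrichedCategory V D]
    (L : EnrichedFunctor V C D) (R : EnrichedFunctor V D C) where
  unit : VNatTrans (EnrichedFunctor.id V C) (L.comp V R)
  counit : VNatTrans (R.comp V L) (EnrichedFunctor.id V D)
  left_triangle (X : C) :
    uComp (unit.app X ≫ L.map X (R.obj (L.obj X))) (counit.app (L.obj X)) = eId V (L.obj X)
  right_triangle (Y : D) :
    uComp (unit.app (R.obj Y)) (counit.app Y ≫ R.map (L.obj (R.obj Y)) Y) = eId V (R.obj Y)

section

variable {C : Type w} [EnrichedCategory V C] {D : Type w'} [EnrichedCategory V D]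
  {L : EnrichedFunctor V C D} {R : EnrichedFunctor V D C}

lemma VAdjunction.counit_naturality (A : VAdjunction L R) (X Y : D) :
    ePre (V := V) (X := L.obj (R.obj X)) (Y := X) (A.counit.app X) Y =
      R.map X Y ≫ L.map (R.obj X) (R.obj Y) ≫
        ePost (V := V) (L.obj (R.obj X)) (Y := L.obj (R.obj Y)) (Z := Y) (A.counit.app Y) := by
  have h := A.counit.naturality X Y
  exact (Category.id_comp _).symm.trans (h.trans (Category.assoc _ _ _))

lemma VAdjunction.mul_naturality (A : VAdjunction L R) (X Y : C) :
    (L.map X Y ≫ R.map (L.obj X) (L.obj Y)) ≫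
        ePre (V := V) (X := R.obj (L.obj (R.obj (L.obj X)))) (Y := R.obj (L.obj X))
          (A.counit.app (L.obj X) ≫ R.map (L.obj (R.obj (L.obj X))) (L.obj X))
          (R.obj (L.obj Y)) =
      ((L.map X Y ≫ R.map (L.obj X) (L.obj Y)) ≫
        L.map (R.obj (L.obj X)) (R.obj (L.obj Y)) ≫
          R.map (L.obj (R.obj (L.obj X))) (L.obj (R.obj (L.obj Y)))) ≫
        ePost (V := V) (R.obj (L.obj (R.obj (L.obj X)))) (Y := R.obj (L.obj (R.obj (L.obj Y))))
          (Z := R.obj (L.obj Y))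
          (A.counit.app (L.obj Y) ≫ R.map (L.obj (R.obj (L.obj Y))) (L.obj Y)) := by
  have h1 := ePre_map R (X := L.obj (R.obj (L.obj X))) (Y := L.obj X)
    (A.counit.app (L.obj X)) (L.obj Y)
  have h2 := ePost_map R (L.obj (R.obj (L.obj X))) (Y := L.obj (R.obj (L.obj Y)))
    (Z := L.obj Y) (A.counit.app (L.obj Y))
  rw [Category.assoc]
  erw [← h1, A.counit_naturality]
  simp only [Category.assoc]
  erw [h2]
  rfl

lemma VAdjunction.mul_right_unit (A : VAdjunction L R) (X : C) :
    uComp (V := V) (X := R.obj (L.obj X)) (Y := R.obj (L.obj (R.obj (L.obj X))))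
      (Z := R.obj (L.obj X))
      (A.unit.app X ≫ L.map X (R.obj (L.obj X)) ≫ R.map (L.obj X) (L.obj (R.obj (L.obj X))))
      (A.counit.app (L.obj X) ≫ R.map (L.obj (R.obj (L.obj X))) (L.obj X)) =
      eId V (R.obj (L.obj X)) := by
  have h1 := uComp_map R (X := L.obj X) (Y := L.obj (R.obj (L.obj X))) (Z := L.obj X)
    (A.unit.app X ≫ L.map X (R.obj (L.obj X))) (A.counit.app (L.obj X))
  have h2 := A.left_triangle X
  rw [← R.map_id, ← h2]
  erw [h1]
  exact congrArg (fun a => uComp a _) (Category.assoc _ _ _).symm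

lemma VAdjunction.mul_assoc (A : VAdjunction L R) (X : C) :
    uComp (V := V) (X := R.obj (L.obj (R.obj (L.obj (R.obj (L.obj X))))))
        (Y := R.obj (L.obj (R.obj (L.obj X)))) (Z := R.obj (L.obj X))
        ((A.counit.app (L.obj X) ≫ R.map (L.obj (R.obj (L.obj X))) (L.obj X)) ≫
          L.map (R.obj (L.obj (R.obj (L.obj X)))) (R.obj (L.obj X)) ≫
            R.map (L.obj (R.obj (L.obj (R.obj (L.obj X))))) (L.obj (R.obj (L.obj X))))
        (A.counit.app (L.obj X) ≫ R.map (L.obj (R.obj (L.obj X))) (L.obj X)) =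
      uComp (V := V) (X := R.obj (L.obj (R.obj (L.obj (R.obj (L.obj X))))))
        (Y := R.obj (L.obj (R.obj (L.obj X)))) (Z := R.obj (L.obj X))
        (A.counit.app (L.obj (R.obj (L.obj X))) ≫
          R.map (L.obj (R.obj (L.obj (R.obj (L.obj X))))) (L.obj (R.obj (L.obj X))))
        (A.counit.app (L.obj X) ≫ R.map (L.obj (R.obj (L.obj X))) (L.obj X)) := by
  generalize hY : L.obj X = Y
  have h1 := uComp_map R (X := L.obj (R.obj (L.obj (R.obj Y)))) (Y := L.obj (R.obj Y)) (Z := Y)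
    ((A.counit.app Y ≫ R.map (L.obj (R.obj Y)) Y) ≫ L.map (R.obj (L.obj (R.obj Y))) (R.obj Y))
    (A.counit.app Y)
  have h2 := uComp_map R (X := L.obj (R.obj (L.obj (R.obj Y)))) (Y := L.obj (R.obj Y)) (Z := Y)
    (A.counit.app (L.obj (R.obj Y))) (A.counit.app Y)
  refine (congrArg (fun a => uComp a _) (Category.assoc _ _ _).symm).trans
    (h1.symm.trans (Eq.trans ?_ h2))
  congr 1
  have h3 := A.counit_naturality (L.obj (R.obj Y)) Y
  refine (comp_ePost _ _).symm.trans (Eq.trans ?_ (comp_ePre _ _))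
  exact (Category.assoc _ _ _).trans ((Category.assoc _ _ _).trans
    (congrArg (fun a => A.counit.app Y ≫ a) h3.symm))

end

/-- The `V`-monad `(R L, η, R ε L)` induced by a `V`-adjunction. -/
def VAdjunction.toVMonad {C : Type w} [EnrichedCategory V C] {D : Type w'} [EnrichedCategory V D]
    {L : EnrichedFunctor V C D} {R : EnrichedFunctor V D C} (A : VAdjunction L R) :
    VMonad (V := V) C where
  functor := L.comp V R
  unit := A.unit
  mul :=
    { app X := A.counit.app (L.obj X) ≫ R.map (L.obj (R.obj (L.obj X))) (L.obj X)
      naturality X Y := A.mul_naturality X Y }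
  left_unit X := A.right_triangle (L.obj X)
  right_unit X := A.mul_right_unit X
  assoc X := A.mul_assoc X

end VNat

section Closed

variable {V : Type u} [Category.{v} V] [MonoidalCategory V] [MonoidalClosed V]

lemma ePre_self {X Y : V} (f : X ⟶ Y) (Z : V) :
    ePre (V := V) (C := V) (MonoidalClosed.curry' f) Z = (MonoidalClosed.pre f).app Z :=
  MonoidalClosed.enrichedOrdinaryCategorySelf_eHomWhiskerRight V f Z

lemma ePost_self (X : V) {Y Z : V} (f : Y ⟶ Z) :
    ePost (V := V) (C := V) X (MonoidalClosed.curry' f) = (ihom X).map f :=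
  MonoidalClosed.enrichedOrdinaryCategorySelf_eHomWhiskerLeft V X f

lemma uComp_self {X Y Z : V} (f : X ⟶ Y) (g : Y ⟶ Z) :
    uComp (V := V) (C := V) (MonoidalClosed.curry' f) (MonoidalClosed.curry' g) =
      MonoidalClosed.curry' (f ≫ g) :=
  (MonoidalClosed.curry'_comp f g).symm

lemma eId_self (X : V) : eId V X = MonoidalClosed.curry' (𝟙 X) :=
  (MonoidalClosed.curry'_id X).symm

end Closed

section Transport

variable {V : Type u} [Category.{v} V] [MonoidalCategory V]
  {W : Type u'} [Category.{v'} W] [MonoidalCategory W] (M : V ⥤ W) [M.LaxMonoidal]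
  {C : Type w} [EnrichedCategory V C]

/-- The element of `M_* C` given by an element of `C`. -/
def transportElt {X Y : C} (a : 𝟙_ V ⟶ (X ⟶[V] Y)) :
    𝟙_ W ⟶ EnrichedCategory.Hom (V := W) (C := TransportEnrichment M C) X Y :=
  ε M ≫ M.map a

lemma ePre_transportElt {X Y : C} (a : 𝟙_ V ⟶ (X ⟶[V] Y)) (Z : C) :
    ePre (V := W) (C := TransportEnrichment M C) (transportElt M a) Z = M.map (ePre a Z) := by
  change (λ_ (M.obj _)).inv ≫ (ε M ≫ M.map a) ▷ M.obj _ ≫ μ M _ _ ≫ M.map (eComp V X Y Z) = _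
  rw [ePre, comp_whiskerRight, Category.assoc, μ_natural_left_assoc, M.map_comp, M.map_comp,
    left_unitality_inv_assoc]

lemma ePost_transportElt (X : C) {Y Z : C} (b : 𝟙_ V ⟶ (Y ⟶[V] Z)) :
    ePost (V := W) (C := TransportEnrichment M C) X (transportElt M b) = M.map (ePost X b) := by
  change (ρ_ (M.obj _)).inv ≫ M.obj _ ◁ (ε M ≫ M.map b) ≫ μ M _ _ ≫ M.map (eComp V X Y Z) = _
  rw [ePost, MonoidalCategory.whiskerLeft_comp, Category.assoc, μ_natural_right_assoc, M.map_comp,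
    M.map_comp, right_unitality_inv_assoc]

lemma uComp_transportElt {X Y Z : C} (a : 𝟙_ V ⟶ (X ⟶[V] Y)) (b : 𝟙_ V ⟶ (Y ⟶[V] Z)) :
    uComp (V := W) (C := TransportEnrichment M C) (transportElt M a) (transportElt M b) =
      transportElt M (uComp a b) := by
  have h : (ε M ≫ M.map a) ≫ M.map (ePost X b) = ε M ≫ M.map (uComp a b) := by
    rw [← comp_ePost, Category.assoc, ← M.map_comp]
  refine (comp_ePost (V := W) (C := TransportEnrichment M C) _ _).symm.trans (Eq.trans ?_ h)
  exact congrArg (fun t => transportElt M a ≫ t) (ePost_transportElt M X b)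

end Transport

section CounitElt

variable {V : Type u} [Category.{v} V] [MonoidalCategory V]
  {W : Type u'} [Category.{v'} W] [MonoidalCategory W] [MonoidalClosed W]
  {F : V ⥤ W} {G : W ⥤ V} [G.LaxMonoidal] (adj : F ⊣ G)

/-- The components `𝟙_ V ⟶ G W(F G X, X)` of the counit of the `V`-adjunction `acute F ⊣ grave G`: the
elements of `G_* W` corresponding to the components of the counit of `F ⊣ G`. -/
def counitElt (X : W) :
    𝟙_ V ⟶ EnrichedCategory.Hom (V := V) (C := TransportEnrichment G W) (F.obj (G.obj X)) X :=
  transportElt G (C := W) (MonoidalClosed.curry' (adj.counit.app X))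

lemma ePre_counitElt (X Y : W) :
    ePre (V := V) (C := TransportEnrichment G W) (counitElt adj X) Y =
      G.map ((MonoidalClosed.pre (adj.counit.app X)).app Y) :=
  (ePre_transportElt G (C := W) _ Y).trans (congrArg (fun t => G.map t) (ePre_self _ _))

lemma ePost_counitElt (X Y : W) :
    ePost (V := V) (C := TransportEnrichment G W) X (counitElt adj Y) =
      G.map ((ihom X).map (adj.counit.app Y)) :=
  (ePost_transportElt G (C := W) X _).trans (congrArg (fun t => G.map t) (ePost_self _ _))

end CounitElt

section Adj

variable {V : Type u} [Category.{v} V] [MonoidalCategory V] [MonoidalClosed V]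
  {W : Type u'} [Category.{v'} W] [MonoidalCategory W] [MonoidalClosed W]

lemma curry'_graveMap (M : V ⥤ W) [M.LaxMonoidal] {X Y : V} (f : X ⟶ Y) :
    ε M ≫ M.map (MonoidalClosed.curry' f) ≫ graveMap M X Y =
      MonoidalClosed.curry' (M.map f) := by
  apply hom_ext_ev
  rw [MonoidalClosed.whiskerLeft_curry'_ihom_ev_app, MonoidalCategory.whiskerLeft_comp,
    MonoidalCategory.whiskerLeft_comp, Category.assoc, Category.assoc, whiskerLeft_graveMap_ev,
    μ_natural_right_assoc, ← M.map_comp, MonoidalClosed.whiskerLeft_curry'_ihom_ev_app,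
    M.map_comp, right_unitality M X, Category.assoc, Category.assoc]

lemma graveMap_comp_functor {U : Type u''} [Category.{v''} U] [MonoidalCategory U]
    [MonoidalClosed U] (M : V ⥤ W) [M.LaxMonoidal] (N : W ⥤ U) [N.LaxMonoidal] (X Y : V) :
    graveMap (M ⋙ N) X Y = N.map (graveMap M X Y) ≫ graveMap N (M.obj X) (M.obj Y) := by
  apply hom_ext_ev
  rw [whiskerLeft_graveMap_ev]
  dsimp only [Functor.comp_obj, Functor.comp_map]
  rw [MonoidalCategory.whiskerLeft_comp, Category.assoc, whiskerLeft_graveMap_ev,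
    μ_natural_right_assoc, ← N.map_comp, whiskerLeft_graveMap_ev, comp_μ, N.map_comp,
    Category.assoc]

/-- Naturality, in the enriched sense, of the unit `η : 𝟭 ⟶ T` with respect to `grave T ∘ η_*`. -/
lemma unit_enriched_naturality (T : V ⥤ V) [T.LaxMonoidal] (α : 𝟭 V ⟶ T) [NatTrans.IsMonoidal α]
    (X Y : V) :
    α.app ((ihom X).obj Y) ≫ graveMap T X Y ≫
      (MonoidalClosed.pre (α.app X)).app (T.obj Y) = (ihom X).map (α.app Y) := by
  have h1 := NatTrans.IsMonoidal.tensor (τ := α) X ((ihom X).obj Y)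
  have h2 := α.naturality ((ihom.ev X).app Y)
  rw [id_μ, Category.id_comp] at h1
  dsimp only [Functor.id_obj, Functor.id_map] at h1 h2
  apply hom_ext_ev
  rw [MonoidalCategory.whiskerLeft_comp, MonoidalCategory.whiskerLeft_comp, Category.assoc,
    Category.assoc, MonoidalClosed.id_tensor_pre_app_comp_ev]
  dsimp only [Functor.id_obj]
  rw [ihom.ev_naturality]
  dsimp only [Functor.id_obj, Functor.comp_obj, curriedTensor_obj_obj] at h2 ⊢
  rw [whisker_exchange_assoc, whiskerLeft_graveMap_ev, h2, h1, MonoidalCategory.tensorHom_def',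
    Category.assoc, Category.assoc]

section

variable {F : V ⥤ W} {G : W ⥤ V} [F.LaxMonoidal] [G.LaxMonoidal] (adj : F ⊣ G)

lemma counit_enriched_naturality [NatTrans.IsMonoidal adj.counit] (X Y : W) :
    F.map (graveMap G X Y) ≫ graveMap F (G.obj X) (G.obj Y) ≫
      (ihom (F.obj (G.obj X))).map (adj.counit.app Y) =
    adj.counit.app ((ihom X).obj Y) ≫ (MonoidalClosed.pre (adj.counit.app X)).app Y := by
  have h1 := NatTrans.IsMonoidal.tensor (τ := adj.counit) X ((ihom X).obj Y)
  have h2 := adj.counit.naturality ((ihom.ev X).app Y)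
  rw [id_μ, Category.comp_id, comp_μ, Category.assoc] at h1
  dsimp only [Functor.id_obj, Functor.id_map, Functor.comp_obj, Functor.comp_map] at h1 h2
  apply hom_ext_ev
  simp only [MonoidalCategory.whiskerLeft_comp, Category.assoc,
    ihom.ev_naturality]
  dsimp only [Functor.id_obj]
  rw [← Category.assoc (F.obj (G.obj X) ◁ graveMap F (G.obj X) (G.obj Y)),
    whiskerLeft_graveMap_ev, Category.assoc, μ_natural_right_assoc, ← Category.assoc (F.map _),
    ← F.map_comp, whiskerLeft_graveMap_ev, F.map_comp, Category.assoc]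
  dsimp only [Functor.id_obj, curriedTensor_obj_obj] at h2 ⊢
  rw [h2, reassoc_of% h1, MonoidalCategory.tensorHom_def', Category.assoc,
    MonoidalClosed.id_tensor_pre_app_comp_ev]

lemma counit_enriched_naturality' [NatTrans.IsMonoidal adj.counit] (X Y : W) :
    G.map ((MonoidalClosed.pre (adj.counit.app X)).app Y) =
      graveMap G X Y ≫ (adj.unit.app ((ihom (G.obj X)).obj (G.obj Y)) ≫
        G.map (graveMap F (G.obj X) (G.obj Y))) ≫
          G.map ((ihom (F.obj (G.obj X))).map (adj.counit.app Y)) := by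
  have h := congrArg (fun t => adj.unit.app (G.obj ((ihom X).obj Y)) ≫ G.map t)
    (counit_enriched_naturality adj X Y)
  have h3 := adj.unit.naturality (graveMap G X Y)
  have h4 := adj.right_triangle_components ((ihom X).obj Y)
  dsimp only [Functor.id_obj, Functor.id_map, Functor.comp_obj, Functor.comp_map] at h h3 h4
  rw [G.map_comp, G.map_comp, G.map_comp, reassoc_of% h4, ← reassoc_of% h3] at h
  rw [← h, Category.assoc]

/-- The `V`-functor `acute F : V ⟶ G_* W`, the transpose of `grave F : F_* V ⟶ W` under the adjunction
`F_* ⊣ G_*`, that is, the composite of the unit `V ⟶ G_* F_* V` with `G_* grave F`. -/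
def acute [NatTrans.IsMonoidal adj.unit] : EnrichedFunctor V V (TransportEnrichment G W) :=
  (changeBaseUnit adj V).comp V (changeBase G (grave F))

lemma curry'_acute [NatTrans.IsMonoidal adj.unit] {X Y : V} (f : X ⟶ Y) :
    MonoidalClosed.curry' f ≫ adj.unit.app ((ihom X).obj Y) ≫ G.map (graveMap F X Y) =
      ε G ≫ G.map (MonoidalClosed.curry' (F.map f)) := by
  rw [← Category.assoc, unit_tensorUnit_naturality adj, Category.assoc, Category.assoc,
    ← G.map_comp, ← G.map_comp, curry'_graveMap]

/-- The `V`-adjunction `acute F ⊣ grave G` with the same unit and counit as `F ⊣ G`. -/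
def enrichedAdjunction [NatTrans.IsMonoidal adj.unit] [NatTrans.IsMonoidal adj.counit] :
    VAdjunction (V := V) (acute adj) (grave G) where
  unit :=
    { app X := MonoidalClosed.curry' (adj.unit.app X)
      naturality X Y := by
        refine (congrArg (fun t => _ ≫ t) (ePre_self _ _)).trans
          (Eq.trans ?_ (congrArg (fun t => _ ≫ t) (ePost_self _ _)).symm)
        refine Eq.trans ?_ ((unit_enriched_naturality (F ⋙ G) adj.unit X Y).trans
          (Category.id_comp _).symm)
        rw [graveMap_comp_functor]
        exact (Category.assoc _ _ _).trans ((Category.assoc _ _ _).trans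
          (congrArg (fun t => _ ≫ t) (Category.assoc _ _ _).symm)) }
  counit :=
    { app X := counitElt adj X
      naturality X Y := by
        refine (congrArg (fun t => _ ≫ t) (ePre_counitElt adj X Y)).trans
          (Eq.trans ?_ (congrArg (fun t => _ ≫ t)
            (ePost_counitElt adj (F.obj (G.obj X)) Y)).symm)
        exact (Category.id_comp _).trans
          ((counit_enriched_naturality' adj X Y).trans (Category.assoc _ _ _).symm) }
  left_triangle X := by
    refine (congrArg (fun t => uComp (V := V) (C := TransportEnrichment G W)
      (X := F.obj X) (Y := F.obj (G.obj (F.obj X))) (Z := F.obj X) t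
        (counitElt adj (F.obj X)))
      (curry'_acute adj (adj.unit.app X))).trans ?_
    refine (uComp_transportElt G (C := W) _ _).trans ?_
    exact congrArg (transportElt G (C := W)) ((uComp_self _ _).trans
      ((congrArg _ (adj.left_triangle_components X)).trans (eId_self (F.obj X)).symm))
  right_triangle X := by
    refine (congrArg (fun t => uComp (V := V) (C := V) (X := G.obj X)
      (Y := G.obj (F.obj (G.obj X))) (Z := G.obj X) (MonoidalClosed.curry' (adj.unit.app _)) t)
      ((Category.assoc _ _ _).trans (curry'_graveMap G (adj.counit.app X)))).trans ?_
    refine (uComp_self _ _).trans ?_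
    exact (congrArg _ (adj.right_triangle_components X)).trans (eId_self (G.obj X)).symm

/-- The `V`-monad on `V` induced by the `V`-adjunction `acute F ⊣ grave G`. -/
def inducedVMonad [NatTrans.IsMonoidal adj.unit] [NatTrans.IsMonoidal adj.counit] :
    VMonad (V := V) V :=
  (enrichedAdjunction adj).toVMonad

end

end Adj

section Commutative

variable {V : Type u} [Category.{v} V] [MonoidalCategory V] [MonoidalClosed V]

namespace VMonad

variable (S : VMonad (V := V) V)

/-- The action on morphisms of the ordinary functor underlying `S`. -/
def mapHom {X Y : V} (f : X ⟶ Y) : S.functor.obj X ⟶ S.functor.obj Y :=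
  MonoidalClosed.uncurry' (MonoidalClosed.curry' f ≫ S.functor.map X Y)

/-- The ordinary multiplication underlying `S`. -/
def mulHom (X : V) : S.functor.obj (S.functor.obj X) ⟶ S.functor.obj X :=
  MonoidalClosed.uncurry' (S.mul.app X)

/-- `t' : T X ⊗ Y ⟶ T (X ⊗ Y)`, the transpose of `Y ⟶ V(X, X ⊗ Y) ⟶ V(T X, T (X ⊗ Y))`. -/
def strengthLeft (X Y : V) : S.functor.obj X ⊗ Y ⟶ S.functor.obj (X ⊗ Y) :=
  MonoidalClosed.uncurry ((ihom.coev X).app Y ≫ S.functor.map X (X ⊗ Y))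

variable [SymmetricCategory V]

/-- `t'' : X ⊗ T Y ⟶ T (X ⊗ Y)`, the transpose of `X ⟶ V(Y, X ⊗ Y) ⟶ V(T Y, T (X ⊗ Y))`. -/
def strengthRight (X Y : V) : X ⊗ S.functor.obj Y ⟶ S.functor.obj (X ⊗ Y) :=
  (β_ X (S.functor.obj Y)).hom ≫
    MonoidalClosed.uncurry (MonoidalClosed.curry (β_ Y X).hom ≫ S.functor.map Y (X ⊗ Y))

/-- The morphism `⊗ : T X ⊗ T Y ⟶ T (X ⊗ Y)`, the composite of `t''`, `T t'` and
multiplication. -/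
def tensor (X Y : V) : S.functor.obj X ⊗ S.functor.obj Y ⟶ S.functor.obj (X ⊗ Y) :=
  S.strengthRight (S.functor.obj X) Y ≫ S.mapHom (S.strengthLeft X Y) ≫ S.mulHom (X ⊗ Y)

/-- The morphism `T X ⊗ T Y ⟶ T (X ⊗ Y)`, the composite of `t'`, `T t''` and multiplication. -/
def tensor' (X Y : V) : S.functor.obj X ⊗ S.functor.obj Y ⟶ S.functor.obj (X ⊗ Y) :=
  S.strengthLeft X (S.functor.obj Y) ≫ S.mapHom (S.strengthRight X Y) ≫ S.mulHom (X ⊗ Y)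

/-- Commutativity of a `V`-monad on `V`. -/
def IsCommutative : Prop := ∀ X Y : V, S.tensor X Y = S.tensor' X Y

end VMonad

end Commutative

section MonadMul

variable {V : Type u} [Category.{v} V] [MonoidalCategory V]
  {W : Type u'} [Category.{v'} W] [MonoidalCategory W]

lemma monad_mul_unit {F : V ⥤ W} {G : W ⥤ V} (adj : F ⊣ G) [F.LaxMonoidal] [G.LaxMonoidal]
    [NatTrans.IsMonoidal adj.counit] :
    ε ((F ⋙ G) ⋙ (F ⋙ G)) ≫ G.map (adj.counit.app (F.obj (𝟙_ V))) = ε (F ⋙ G) := by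
  have h := NatTrans.IsMonoidal.unit (τ := adj.counit)
  have h2 := adj.counit.naturality (ε F)
  rw [id_ε, comp_ε, Category.assoc] at h
  dsimp only [Functor.id_obj, Functor.id_map, Functor.comp_obj, Functor.comp_map] at h h2
  simp only [comp_ε, Functor.comp_map, Functor.map_comp, Category.assoc]
  rw [← G.map_comp (F.map (G.map (ε F))), h2, ← G.map_comp, ← G.map_comp, reassoc_of% h]

lemma monad_mul_tensor {F : V ⥤ W} {G : W ⥤ V} (adj : F ⊣ G) [F.LaxMonoidal] [G.LaxMonoidal]
    [NatTrans.IsMonoidal adj.counit] (X Y : V) :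
    μ ((F ⋙ G) ⋙ (F ⋙ G)) X Y ≫ G.map (adj.counit.app (F.obj (X ⊗ Y))) =
      (G.map (adj.counit.app (F.obj X)) ⊗ₘ G.map (adj.counit.app (F.obj Y))) ≫
        μ (F ⋙ G) X Y := by
  have h := NatTrans.IsMonoidal.tensor (τ := adj.counit) (F.obj X) (F.obj Y)
  have h2 := adj.counit.naturality (μ F X Y)
  rw [id_μ, comp_μ, Category.assoc, Category.comp_id] at h
  dsimp only [Functor.id_obj, Functor.id_map, Functor.comp_obj, Functor.comp_map] at h h2
  rw [comp_μ, comp_μ, comp_μ]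
  dsimp only [Functor.comp_obj, Functor.comp_map]
  have h3 := μ_natural G (adj.counit.app (F.obj X)) (adj.counit.app (F.obj Y))
  dsimp only [Functor.id_obj] at h3
  rw [reassoc_of% h3, ← G.map_comp, ← h]
  simp only [Category.assoc, ← G.map_comp, F.map_comp]
  rw [h2]

end MonadMul

section MonoidalMonad

variable {V : Type u} [Category.{v} V] [MonoidalCategory V] [SymmetricCategory V]

/-- A symmetric monoidal monad structure on an ordinary monad: a symmetric (lax) monoidal structure
on the functor for which the unit and the multiplication are monoidal. -/
class SymmetricMonoidalMonad (T : Monad V) extends T.toFunctor.LaxBraided where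
  unit_isMonoidal : NatTrans.IsMonoidal T.η
  mul_isMonoidal : NatTrans.IsMonoidal T.μ

attribute [instance] SymmetricMonoidalMonad.unit_isMonoidal SymmetricMonoidalMonad.mul_isMonoidal

variable {W : Type u'} [Category.{v'} W] [MonoidalCategory W] [SymmetricCategory W]

instance laxBraidedToMonad {F : V ⥤ W} {G : W ⥤ V} (adj : F ⊣ G) [F.LaxBraided]
    [G.LaxBraided] : adj.toMonad.toFunctor.LaxBraided :=
  (inferInstance : (F ⋙ G).LaxBraided)

/-- The symmetric monoidal monad induced by a symmetric monoidal adjunction. -/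
instance symmetricMonoidalMonadOfAdjunction {F : V ⥤ W} {G : W ⥤ V} (adj : F ⊣ G) [F.LaxBraided]
    [G.LaxBraided] [NatTrans.IsMonoidal adj.unit] [NatTrans.IsMonoidal adj.counit] :
    SymmetricMonoidalMonad adj.toMonad where
  toLaxBraided := laxBraidedToMonad adj
  unit_isMonoidal := (inferInstance : NatTrans.IsMonoidal adj.unit)
  mul_isMonoidal := ⟨monad_mul_unit adj, monad_mul_tensor adj⟩

end MonoidalMonad

section Kock

variable {V : Type u} [Category.{v} V] [MonoidalCategory V] [MonoidalClosed V]

/-- A `V`-enrichment of the functor `T` making the ordinary monad `T` a `V`-monad on `V`: a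
`V`-functor structure on `T` with underlying ordinary functor `T`, such that the unit and the
multiplication of `T` are `V`-natural. -/
structure MonadEnrichment (T : Monad V) where
  map (X Y : V) : (ihom X).obj Y ⟶ (ihom (T.obj X)).obj (T.obj Y)
  map_id (X : V) : MonoidalClosed.id X ≫ map X X = MonoidalClosed.id (T.obj X)
  map_comp (X Y Z : V) : MonoidalClosed.comp X Y Z ≫ map X Z =
    (map X Y ⊗ₘ map Y Z) ≫ MonoidalClosed.comp (T.obj X) (T.obj Y) (T.obj Z)
  map_curry' {X Y : V} (f : X ⟶ Y) :
    MonoidalClosed.curry' f ≫ map X Y = MonoidalClosed.curry' (T.map f)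
  unit_naturality (X Y : V) :
    map X Y ≫ (MonoidalClosed.pre (T.η.app X)).app (T.obj Y) = (ihom X).map (T.η.app Y)
  mul_naturality (X Y : V) :
    map X Y ≫ (MonoidalClosed.pre (T.μ.app X)).app (T.obj Y) =
      (map X Y ≫ map (T.obj X) (T.obj Y)) ≫ (ihom (T.obj (T.obj X))).map (T.μ.app Y)

/-- The `V`-monad on `V` determined by an enrichment of an ordinary monad. -/
def MonadEnrichment.toVMonad {T : Monad V} (E : MonadEnrichment T) : VMonad (V := V) V where
  functor :=
    { obj X := T.obj X
      map X Y := E.map X Y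
      map_id X := E.map_id X
      map_comp X Y Z := E.map_comp X Y Z }
  unit :=
    { app X := MonoidalClosed.curry' (T.η.app X)
      naturality X Y := by
        refine (congrArg (fun t => _ ≫ t) (ePre_self _ _)).trans
          (Eq.trans ?_ (congrArg (fun t => _ ≫ t) (ePost_self _ _)).symm)
        exact (E.unit_naturality X Y).trans (Category.id_comp _).symm }
  mul :=
    { app X := MonoidalClosed.curry' (T.μ.app X)
      naturality X Y := by
        refine (congrArg (fun t => _ ≫ t) (ePre_self _ _)).trans
          (Eq.trans ?_ (congrArg (fun t => _ ≫ t) (ePost_self _ _)).symm)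
        exact E.mul_naturality X Y }
  left_unit X := by
    refine (uComp_self (T.η.app (T.obj X)) (T.μ.app X)).trans ?_
    exact (congrArg _ (T.left_unit X)).trans (eId_self (T.obj X)).symm
  right_unit X := by
    refine (congrArg (fun t => uComp (V := V) (C := V) (X := T.obj X) (Y := T.obj (T.obj X))
      (Z := T.obj X) t (MonoidalClosed.curry' (T.μ.app X))) (E.map_curry' (T.η.app X))).trans ?_
    refine (uComp_self _ _).trans ?_
    exact (congrArg _ (T.right_unit X)).trans (eId_self (T.obj X)).symm
  assoc X := by
    refine (congrArg (fun t => uComp (V := V) (C := V) (X := T.obj (T.obj (T.obj X)))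
      (Y := T.obj (T.obj X)) (Z := T.obj X) t (MonoidalClosed.curry' (T.μ.app X)))
      (E.map_curry' (T.μ.app X))).trans ?_
    refine (uComp_self _ _).trans (Eq.trans ?_ (uComp_self _ _).symm)
    exact congrArg _ (T.assoc X)

variable [SymmetricCategory V]

/-- `V(X, Y) ⟶ V(T X, T Y)`, the transpose of the composite
`T X ⊗ V(X, Y) ⟶ T X ⊗ T V(X, Y) ⟶ T (X ⊗ V(X, Y)) ⟶ T Y`. -/
def kockMap (T : Monad V) [SymmetricMonoidalMonad T] (X Y : V) :
    (ihom X).obj Y ⟶ (ihom (T.obj X)).obj (T.obj Y) :=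
  MonoidalClosed.curry (T.obj X ◁ T.η.app ((ihom X).obj Y) ≫
    μ T.toFunctor X ((ihom X).obj Y) ≫ T.map ((ihom.ev X).app Y))

lemma kockMap_eq (T : Monad V) [SymmetricMonoidalMonad T] (X Y : V) :
    kockMap T X Y = T.η.app ((ihom X).obj Y) ≫ graveMap T.toFunctor X Y :=
  MonoidalClosed.curry_natural_left _ _

/-- The `V`-enrichment of the ordinary monad `T` associated with a symmetric monoidal monad. -/
def kockEnrichment (T : Monad V) [SymmetricMonoidalMonad T] : MonadEnrichment T where
  map X Y := kockMap T X Y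
  map_id X := by
    have h := NatTrans.IsMonoidal.unit (τ := T.η)
    have h2 := T.η.naturality (MonoidalClosed.id X)
    rw [id_ε, Category.id_comp] at h
    dsimp only [Functor.id_obj, Functor.id_map] at h h2
    rw [kockMap_eq, reassoc_of% h2, h, ← Category.assoc, graveMap_id]
  map_comp X Y Z := by
    have h := NatTrans.IsMonoidal.tensor (τ := T.η) ((ihom X).obj Y) ((ihom Y).obj Z)
    have h2 := T.η.naturality (MonoidalClosed.comp X Y Z)
    rw [id_μ, Category.id_comp] at h
    dsimp only [Functor.id_obj, Functor.id_map] at h h2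
    rw [kockMap_eq, kockMap_eq, kockMap_eq, reassoc_of% h2, h,
      ← MonoidalCategory.tensorHom_comp_tensorHom, Category.assoc, Category.assoc,
      ← graveMap_comp, Category.assoc]
  map_curry' {X Y} f := by
    have h := NatTrans.IsMonoidal.unit (τ := T.η)
    have h2 := T.η.naturality (MonoidalClosed.curry' f)
    rw [id_ε, Category.id_comp] at h
    dsimp only [Functor.id_obj, Functor.id_map] at h h2
    rw [kockMap_eq, reassoc_of% h2, h, curry'_graveMap]
  unit_naturality X Y := by
    rw [kockMap_eq, Category.assoc, unit_enriched_naturality]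
  mul_naturality X Y := by
    have h1 := NatTrans.IsMonoidal.tensor (τ := T.μ) X ((ihom X).obj Y)
    have h2 := T.μ.naturality ((ihom.ev X).app Y)
    have h3 := T.η.naturality (kockMap T X Y)
    have h4 := T.right_unit ((ihom X).obj Y)
    have h5 : T.obj X ◁ kockMap T X Y ≫ (ihom.ev (T.obj X)).app (T.obj Y) =
        T.obj X ◁ T.η.app ((ihom X).obj Y) ≫
          μ T.toFunctor X ((ihom X).obj Y) ≫ T.map ((ihom.ev X).app Y) :=
      MonoidalClosed.whiskerLeft_curry_ihom_ev_app _ _ _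
    have h6 : T.obj (T.obj X) ◁ kockMap T (T.obj X) (T.obj Y) ≫
        (ihom.ev (T.obj (T.obj X))).app (T.obj (T.obj Y)) =
        T.obj (T.obj X) ◁ T.η.app ((ihom (T.obj X)).obj (T.obj Y)) ≫
          μ T.toFunctor (T.obj X) ((ihom (T.obj X)).obj (T.obj Y)) ≫
            T.map ((ihom.ev (T.obj X)).app (T.obj Y)) :=
      MonoidalClosed.whiskerLeft_curry_ihom_ev_app _ _ _
    rw [comp_μ, Category.assoc] at h1
    dsimp only [Functor.id_obj, Functor.id_map, Functor.comp_obj, Functor.comp_map,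
      curriedTensor_obj_obj] at h1 h2 h3 h4 h5 h6
    apply hom_ext_ev
    simp only [MonoidalCategory.whiskerLeft_comp, Category.assoc]
    rw [MonoidalClosed.id_tensor_pre_app_comp_ev]
    dsimp only [Functor.id_obj, Functor.comp_obj]
    rw [ihom.ev_naturality]
    dsimp only [Functor.id_obj]
    rw [whisker_exchange_assoc, h5, reassoc_of% h6, ← MonoidalCategory.whiskerLeft_comp_assoc, h3,
      MonoidalCategory.whiskerLeft_comp, Category.assoc, μ_natural_right_assoc,
      ← T.map_comp_assoc, h5, T.map_comp, T.map_comp, Category.assoc, Category.assoc, h2,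
      ← μ_natural_right_assoc, reassoc_of% h1, MonoidalCategory.tensorHom_def',
      Category.assoc, ← MonoidalCategory.whiskerLeft_comp_assoc,
      ← MonoidalCategory.whiskerLeft_comp_assoc, Category.assoc, h4, Category.comp_id]
    rw [whisker_exchange_assoc]

/-- Kock's correspondence: the `V`-enrichment `E` of the ordinary monad `T` and the given symmetric
monoidal structure on `T` correspond if `E` makes `T` a commutative `V`-monad and the monoidal
structure consists of the morphisms `⊗ : T X ⊗ T Y ⟶ T (X ⊗ Y)` of `E` and the unit of `T`. -/
structure KockCorresponds {T : Monad V} (E : MonadEnrichment T) [SymmetricMonoidalMonad T] :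
    Prop where
  isCommutative : E.toVMonad.IsCommutative
  tensor_eq (X Y : V) : E.toVMonad.tensor X Y = μ T.toFunctor X Y
  unit_eq : T.η.app (𝟙_ V) = ε T.toFunctor

end Kock

end EnrichedMonadTheory

open EnrichedMonadTheory

/-! Write φ : TX ⊗ TY ⟶ T(X ⊗ Y) for the monoidal structure of T and m for the multiplication of the
monad.

Uniqueness in Kock's correspondence: an enrichment can be recovered from its strength t', since the
transpose of T_{XY} is t' followed by T(Ev) (`uncurry_map`). The strength can in turn be recovered
from ⊗, since restricting ⊗ along 1 ⊗ η gives t' (`whiskerLeft_unit_tensor`). Hence ⊗ = φ forces the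
transpose of T_{XY} to be (1 ⊗ η) ≫ φ ≫ T(Ev), which is the definition of the enrichment
`kockEnrichment`.

Existence: for `kockEnrichment` the strengths are t' = (1 ⊗ η) ≫ φ and t'' = (η ⊗ 1) ≫ φ. Both ⊗ and
its mirror image then reduce to φ, because m is monoidal and the unit laws of the monad cancel each
η against an m (`tensor_kockEnrichment`, `tensor'_kockEnrichment`). In particular the two agree,
which is commutativity.

Comparison with the adjunction: the hom map of `kockEnrichment` is η followed by the comparison map
`graveMap` of T = GF. That comparison map factors as G of the one for F followed by the one for G.
Bracketed the other way, the composite is the acute functor of F followed by the grave functor of G.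
The units and multiplications also match, so the two enriched monads are equal, and commutativity
passes from one to the other. -/

namespace EnrichedMonadTheory

universe w v v' u u'

/-! ### Equality of enriched monads -/

section Extensionality

variable {V : Type u} [Category.{v} V] [MonoidalCategory V] {C : Type w} [EnrichedCategory V C]

/-- `V`-monads with the same action on objects are equal if they have the same actions on homs,
units and multiplications. -/
lemma VMonad.ext_of_obj_eq {obj : C → C}
    {map map' : ∀ X Y : C, (X ⟶[V] Y) ⟶ (obj X ⟶[V] obj Y)} {map_id map_comp map_id' map_comp'}
    {unit : VNatTrans (EnrichedFunctor.id V C) ⟨obj, map, map_id, map_comp⟩}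
    {mul : VNatTrans (EnrichedFunctor.comp V ⟨obj, map, map_id, map_comp⟩
      ⟨obj, map, map_id, map_comp⟩) ⟨obj, map, map_id, map_comp⟩}
    {unit' : VNatTrans (EnrichedFunctor.id V C) ⟨obj, map', map_id', map_comp'⟩}
    {mul' : VNatTrans (EnrichedFunctor.comp V ⟨obj, map', map_id', map_comp'⟩
      ⟨obj, map', map_id', map_comp'⟩) ⟨obj, map', map_id', map_comp'⟩}
    {left_unit right_unit assoc left_unit' right_unit' assoc'}
    (hmap : ∀ X Y, map X Y = map' X Y) (hunit : ∀ X, unit.app X = unit'.app X)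
    (hmul : ∀ X, mul.app X = mul'.app X) :
    VMonad.mk (V := V) ⟨obj, map, map_id, map_comp⟩ unit mul left_unit right_unit assoc =
      VMonad.mk ⟨obj, map', map_id', map_comp'⟩ unit' mul' left_unit' right_unit' assoc' := by
  -- The types of the units and multiplications depend on `map`, so the hom maps are identified
  -- first. All fields left after the components are propositions.
  obtain rfl : map = map' := funext₂ hmap
  obtain ⟨app, _⟩ := unit
  obtain ⟨app', _⟩ := unit'
  obtain ⟨app₂, _⟩ := mul
  obtain ⟨app₂', _⟩ := mul'
  obtain rfl : app = app' := funext hunit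
  obtain rfl : app₂ = app₂' := funext hmul
  rfl

end Extensionality

/-! ### Strengths of an enriched monad and Kock's correspondence -/

section Kock

variable {V : Type u} [Category.{v} V] [MonoidalCategory V] [MonoidalClosed V]

namespace MonadEnrichment

variable {T : Monad V}

lemma ext_of_map {E E' : MonadEnrichment T} (h : ∀ X Y, E.map X Y = E'.map X Y) : E = E' := by
  obtain ⟨map, _⟩ := E
  obtain ⟨map', _⟩ := E'
  obtain rfl : map = map' := funext₂ h
  rfl

variable (E : MonadEnrichment T)

lemma mapHom_toVMonad {X Y : V} (f : X ⟶ Y) : E.toVMonad.mapHom f = T.map f :=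
  (congrArg MonoidalClosed.uncurry' (E.map_curry' f)).trans (MonoidalClosed.uncurry'_curry' _)

lemma mulHom_toVMonad (X : V) : E.toVMonad.mulHom X = T.μ.app X :=
  MonoidalClosed.uncurry'_curry' _

/-- Postcomposition with f is enriched composition with the element `curry' f`. An enriched functor
respects composition, and `map_curry'` says that it sends this element to the one naming T f. -/
lemma map_postcomp (X : V) {Y Z : V} (f : Y ⟶ Z) :
    (ihom X).map f ≫ E.map X Z = E.map X Y ≫ (ihom (T.obj X)).map (T.map f) := by
  have h := ePost_map E.toVMonad.functor X (MonoidalClosed.curry' f)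
  refine (congrArg (fun t => t ≫ E.map X Z) (ePost_self X f)).symm.trans (h.trans ?_)
  refine congrArg (fun t => E.map X Y ≫ t) (Eq.trans ?_ (ePost_self (T.obj X) (T.map f)))
  exact congrArg (fun t => ePost (V := V) (C := V) (T.obj X) t) (E.map_curry' f)

/-- The strength `t' : T X ⊗ Y ⟶ T (X ⊗ Y)` of an enriched monad. -/
def strengthLeft (X Y : V) : T.obj X ⊗ Y ⟶ T.obj (X ⊗ Y) :=
  MonoidalClosed.uncurry ((ihom.coev X).app Y ≫ E.map X (X ⊗ Y))

/-- The enrichment is recovered from the strength `t'`. -/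
lemma uncurry_map (X Y : V) : MonoidalClosed.uncurry (E.map X Y) =
    E.strengthLeft X ((ihom X).obj Y) ≫ T.map ((ihom.ev X).app Y) := by
  have h := E.map_postcomp X ((ihom.ev X).app Y)
  have h2 := ihom.coev_ev X Y
  dsimp only [Functor.id_obj, Functor.comp_obj, curriedTensor_obj_obj] at h h2
  rw [strengthLeft, ← MonoidalClosed.uncurry_natural_right, Category.assoc]
  dsimp only [Functor.id_obj, Functor.comp_obj, curriedTensor_obj_obj]
  -- T(Ev) has been moved inside the transpose. Naturality carries it across `E.map` as Ev, where it
  -- cancels the coevaluation by a triangle identity.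
  rw [← h, reassoc_of% h2]

variable [SymmetricCategory V]

/-- The strength `t'' : X ⊗ T Y ⟶ T (X ⊗ Y)` of an enriched monad. -/
def strengthRight (X Y : V) : X ⊗ T.obj Y ⟶ T.obj (X ⊗ Y) :=
  (β_ X (T.obj Y)).hom ≫
    MonoidalClosed.uncurry (MonoidalClosed.curry (β_ Y X).hom ≫ E.map Y (X ⊗ Y))

/-- Only the underlying functor and multiplication of `E.toVMonad` need identifying with those of
`T`; the strengths agree by definition. Expressing everything through `T.obj` lets the ordinary
monad laws of `T` be applied. -/
lemma toVMonad_tensor (X Y : V) : E.toVMonad.tensor X Y =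
    (E.strengthRight (T.obj X) Y ≫ T.map (E.strengthLeft X Y) ≫ T.μ.app (X ⊗ Y) :) := by
  have h : E.toVMonad.tensor X Y = (E.strengthRight (T.obj X) Y ≫
    E.toVMonad.mapHom (E.strengthLeft X Y) ≫ E.toVMonad.mulHom (X ⊗ Y) :) := rfl
  rw [h, mapHom_toVMonad, mulHom_toVMonad]
  rfl

lemma toVMonad_tensor' (X Y : V) : E.toVMonad.tensor' X Y =
    (E.strengthLeft X (T.obj Y) ≫ T.map (E.strengthRight X Y) ≫ T.μ.app (X ⊗ Y) :) := by
  have h : E.toVMonad.tensor' X Y = (E.strengthLeft X (T.obj Y) ≫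
    E.toVMonad.mapHom (E.strengthRight X Y) ≫ E.toVMonad.mulHom (X ⊗ Y) :) := rfl
  rw [h, mapHom_toVMonad, mulHom_toVMonad]
  rfl

/-- This is the transpose of the enriched naturality of η: `E.map` followed by precomposition with
η_Y is postcomposition with η_{X ⊗ Y}. The braiding in t'' and the one inside the curried map X ⟶
V(Y, X ⊗ Y) cancel by symmetry. -/
lemma whiskerLeft_unit_strengthRight (X Y : V) :
    X ◁ T.η.app Y ≫ E.strengthRight X Y = T.η.app (X ⊗ Y) := by
  have h : Y ◁ MonoidalClosed.curry (β_ Y X).hom ≫ (ihom.ev Y).app (X ⊗ Y) = (β_ Y X).hom :=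
    MonoidalClosed.whiskerLeft_curry_ihom_ev_app _ _ _
  have h2 := E.unit_naturality Y (X ⊗ Y)
  have h3 := MonoidalClosed.id_tensor_pre_app_comp_ev (T.η.app Y) (T.obj (X ⊗ Y))
  dsimp only [Functor.id_obj] at h h2 h3
  rw [strengthRight, MonoidalClosed.uncurry_eq, MonoidalCategory.whiskerLeft_comp]
  dsimp only [Functor.id_obj]
  rw [BraidedCategory.braiding_naturality_right_assoc, Category.assoc,
    ← whisker_exchange_assoc, ← whisker_exchange_assoc, ← h3,
    ← MonoidalCategory.whiskerLeft_comp_assoc Y (E.map _ _), h2, ihom.ev_naturality]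
  dsimp only [Functor.id_obj]
  rw [reassoc_of% h, SymmetricCategory.symmetry_assoc]

/-- The strength `t'` is the restriction of `⊗` along the unit. -/
lemma whiskerLeft_unit_tensor (X Y : V) :
    T.obj X ◁ T.η.app Y ≫ E.strengthRight (T.obj X) Y ≫ T.map (E.strengthLeft X Y) ≫
      T.μ.app (X ⊗ Y) = E.strengthLeft X Y := by
  have h := T.η.naturality (E.strengthLeft X Y)
  have h2 := T.left_unit (X ⊗ Y)
  have h3 := E.whiskerLeft_unit_strengthRight (T.obj X) Y
  dsimp only [Functor.id_obj, Functor.id_map] at h h2 h3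
  -- η absorbs t'', leaving η at TX ⊗ Y. Naturality moves it past t', and there the left unit law
  -- cancels it against the multiplication.
  rw [reassoc_of% h3, ← reassoc_of% h, h2, Category.comp_id]

end MonadEnrichment

/-! ### The enrichment coming from a symmetric monoidal monad -/

variable [SymmetricCategory V] (T : Monad V) [SymmetricMonoidalMonad T]

/-- The tensor morphisms determine t', and t' determines the enrichment. -/
lemma eq_kockEnrichment_of_tensor_eq {E : MonadEnrichment T}
    (h : ∀ X Y, E.toVMonad.tensor X Y = μ T.toFunctor X Y) : E = kockEnrichment T := by
  have h2 (X Y : V) := (E.toVMonad_tensor X Y).symm.trans (h X Y)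
  refine MonadEnrichment.ext_of_map fun X Y => MonoidalClosed.uncurry_injective ?_
  rw [E.uncurry_map, ← E.whiskerLeft_unit_tensor, h2]
  exact ((MonoidalClosed.uncurry_curry _).trans (Category.assoc _ _ _).symm).symm

/-- Both strengths are transposes of this kind, with f the coevaluation for t' and the curried
braiding for t''. Naturality of η and of the monoidal structure moves f under T, where it meets Ev.
-/
lemma uncurry_comp_kockMap {A X Y : V} (f : A ⟶ (ihom X).obj Y) :
    MonoidalClosed.uncurry (f ≫ kockMap T X Y) =
      T.obj X ◁ T.η.app A ≫ μ T.toFunctor X A ≫ T.map (MonoidalClosed.uncurry f) := by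
  have h := T.η.naturality f
  dsimp only [Functor.id_obj, Functor.id_map] at h
  rw [MonoidalClosed.uncurry_natural_left, kockMap, MonoidalClosed.uncurry_curry,
    ← MonoidalCategory.whiskerLeft_comp_assoc, h, MonoidalCategory.whiskerLeft_comp_assoc,
    μ_natural_right_assoc, ← T.map_comp, MonoidalClosed.uncurry_eq]

lemma strengthLeft_kockEnrichment (X Y : V) :
    (kockEnrichment T).strengthLeft X Y = T.obj X ◁ T.η.app Y ≫ μ T.toFunctor X Y := by
  refine (uncurry_comp_kockMap T ((ihom.coev X).app Y)).trans ?_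
  rw [MonoidalClosed.uncurry_eq]
  dsimp only [Functor.id_obj, Functor.comp_obj, curriedTensor_obj_obj]
  -- The transpose of the coevaluation is the identity, so no factor under T remains.
  rw [ihom.ev_coev, T.map_id]
  simp

/-- Here the symmetry of the monoidal functor T enters: it turns T of the braiding into a braiding
of TY with TX, which cancels the outer braiding of t'' once η has been moved past it. -/
lemma strengthRight_kockEnrichment (X Y : V) :
    (kockEnrichment T).strengthRight X Y = T.η.app X ▷ T.obj Y ≫ μ T.toFunctor X Y := by
  have h := Functor.LaxBraided.braided (F := T.toFunctor) Y X
  refine (congrArg (fun t => (β_ X (T.obj Y)).hom ≫ t)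
    (uncurry_comp_kockMap T (MonoidalClosed.curry (β_ Y X).hom))).trans ?_
  rw [MonoidalClosed.uncurry_curry, h, ← BraidedCategory.braiding_naturality_left_assoc]
  simp

/-- By naturality the composite is η_{TX} ⊗ Tη_Y followed by the monoidal structure of TT and the
multiplication. As the multiplication is monoidal, it can be applied in each factor first, where the
left unit law at X and the right unit law at Y leave identities. -/
lemma tensor_kockEnrichment (X Y : V) :
    (kockEnrichment T).toVMonad.tensor X Y = μ T.toFunctor X Y := by
  refine ((kockEnrichment T).toVMonad_tensor X Y).trans ?_
  have h := NatTrans.IsMonoidal.tensor (τ := T.μ) X Y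
  have h2 := T.left_unit X
  have h3 := T.right_unit Y
  rw [comp_μ, Category.assoc] at h
  dsimp only [Functor.id_obj, Functor.comp_obj] at h h2 h3
  rw [strengthRight_kockEnrichment, strengthLeft_kockEnrichment,
    T.map_comp, Category.assoc, Category.assoc, ← μ_natural_right_assoc, h,
    MonoidalCategory.tensorHom_def', Category.assoc, ← MonoidalCategory.whiskerLeft_comp_assoc,
    h3, MonoidalCategory.whiskerLeft_id, Category.id_comp, ← comp_whiskerRight_assoc, h2]
  exact (congrArg (fun t => t ≫ μ T.toFunctor X Y) (id_whiskerRight _ _)).trans (Category.id_comp _)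

/-- The mirror argument: the factors are now Tη_X and η_{TY}, so the two unit laws exchange roles.
-/
lemma tensor'_kockEnrichment (X Y : V) :
    (kockEnrichment T).toVMonad.tensor' X Y = μ T.toFunctor X Y := by
  refine ((kockEnrichment T).toVMonad_tensor' X Y).trans ?_
  have h := NatTrans.IsMonoidal.tensor (τ := T.μ) X Y
  have h2 := T.right_unit X
  have h3 := T.left_unit Y
  rw [comp_μ, Category.assoc] at h
  dsimp only [Functor.id_obj, Functor.comp_obj] at h h2 h3
  rw [strengthRight_kockEnrichment, strengthLeft_kockEnrichment,
    T.map_comp, Category.assoc, Category.assoc, ← μ_natural_left_assoc, h,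
    MonoidalCategory.tensorHom_def, Category.assoc, ← comp_whiskerRight_assoc, h2,
    id_whiskerRight, Category.id_comp, ← MonoidalCategory.whiskerLeft_comp_assoc, h3]
  exact (congrArg (fun t => t ≫ μ T.toFunctor X Y) (MonoidalCategory.whiskerLeft_id _ _)).trans
    (Category.id_comp _)

lemma kockCorresponds_kockEnrichment : KockCorresponds (kockEnrichment T) where
  isCommutative X Y := (tensor_kockEnrichment T X Y).trans (tensor'_kockEnrichment T X Y).symm
  tensor_eq := tensor_kockEnrichment T
  unit_eq := by
    -- The unit condition is the nullary part of η being monoidal.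
    have h := NatTrans.IsMonoidal.unit (τ := T.η)
    rwa [id_ε, Category.id_comp] at h

lemma kockCorresponds_iff (E : MonadEnrichment T) :
    KockCorresponds E ↔ E = kockEnrichment T := by
  refine ⟨fun h => eq_kockEnrichment_of_tensor_eq T h.tensor_eq, ?_⟩
  rintro rfl
  exact kockCorresponds_kockEnrichment T

end Kock

/-! ### Comparison with the monad induced by the enriched adjunction -/

section Adjunction

variable {V : Type u} [Category.{v} V] [MonoidalCategory V] [SymmetricCategory V]
  [MonoidalClosed V] {W : Type u'} [Category.{v'} W] [MonoidalCategory W] [SymmetricCategory W]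
  [MonoidalClosed W] {F : V ⥤ W} {G : W ⥤ V} [F.LaxBraided] [G.LaxBraided] (adj : F ⊣ G)
  [NatTrans.IsMonoidal adj.unit] [NatTrans.IsMonoidal adj.counit]

lemma toVMonad_kockEnrichment :
    (kockEnrichment adj.toMonad).toVMonad = inducedVMonad adj := by
  refine VMonad.ext_of_obj_eq (fun X Y => ?_) (fun X => rfl) (fun X => ?_)
  -- On homs the claim is the factorization of the comparison map of F ⋙ G, up to rebracketing.
  · refine (kockMap_eq adj.toMonad X Y).trans ?_
    refine (congrArg (fun t => adj.unit.app ((ihom X).obj Y) ≫ t)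
      (graveMap_comp_functor F G X Y)).trans ?_
    exact (Category.assoc _ _ _).symm
  -- The enriched multiplication is the image under the grave functor of G of the counit element at
  -- FX; this image is the element naming Gε_{FX}, the ordinary multiplication.
  · exact ((Category.assoc _ _ _).trans (curry'_graveMap G (adj.counit.app (F.obj X)))).symm

lemma isCommutative_inducedVMonad : (inducedVMonad adj).IsCommutative :=
  toVMonad_kockEnrichment adj ▸ (kockCorresponds_kockEnrichment adj.toMonad).isCommutative

end Adjunction

end EnrichedMonadTheory

theorem mainTheorem4
    {𝒳 : Type*} [Category 𝒳] [MonoidalCategory 𝒳] [SymmetricCategory 𝒳] [MonoidalClosed 𝒳]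
    {𝒲 : Type*} [Category 𝒲] [MonoidalCategory 𝒲] [SymmetricCategory 𝒲] [MonoidalClosed 𝒲]
    {F : 𝒳 ⥤ 𝒲} {G : 𝒲 ⥤ 𝒳} [F.LaxBraided] [G.LaxBraided] (adj : F ⊣ G)
    [NatTrans.IsMonoidal adj.unit] [NatTrans.IsMonoidal adj.counit] :
    (∀ E : MonadEnrichment adj.toMonad,
      KockCorresponds E ↔ E = kockEnrichment adj.toMonad) ∧
    (kockEnrichment adj.toMonad).toVMonad = inducedVMonad adj ∧
    (inducedVMonad adj).IsCommutative :=
  ⟨kockCorresponds_iff adj.toMonad, toVMonad_kockEnrichment adj, isCommutative_inducedVMonad adj⟩
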